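/- Let $\mathcal M$ be a closed (compact, boundaryless, finite-dimensional) smooth manifold and $\mathcal H$ a real, separable, infinite-dimensional Hilbert space with an orthogonal basis $e_1,e_2,\dots$ (nonzero, pairwise orthogonal vectors with dense linear span); put $\mathcal H_d:=\mathrm{span}(e_1,\dots,e_d)$. Let $\mathcal E\to\mathcal M$ be a smooth Hilbert bundle with generic fiber $\mathcal H$, i.e. a smooth vector bundle modelled on $\mathcal H$ whose fibers carry inner products $\langle\cdot,\cdot\rangle_x$, inducing the topology of the fibers and depending smoothly on $x$. A smooth connection $\nabla$ on $\mathcal E$ is called compatible if $X\langle\sigma,\tau\rangle=\langle\nabla_X\sigma,\tau\rangle+\langle\sigma,\nabla_X\tau\rangle$ for all smooth vector fields $X$ and smooth sections $\sigma,\tau$. Then there are smooth subbundles $\mathcal E_d\subset\mathcal E$, $d\ge 0$, with generic fiber $\mathcal H_d$ and with the inner products inherited from $\mathcal E$, such that $\mathcal E_{d,x}\subset\mathcal E_{d+1,x}$ and $\bigcup_d\mathcal E_{d,x}$ has dense span in $\mathcal E_x$ for every $x\in\mathcal M$, and such that for every $d$: 1. $\mathcal E_d$ has rank $d$, and the map $\Pi_d:\mathcal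 E\to\mathcal E_d$ which on each fiber is the orthogonal projection $\mathcal E_x\to\mathcal E_{d,x}$ is a smooth map of bundles. 2. Near every point of $\mathcal M$ there is a smooth local trivialization $\mathcal E|_U\cong U\times\mathcal H$, linear on fibers, which carries $\Pi_d$ to the orthogonal projection $\mathcal H\to\mathcal H_d$ on each fiber (and hence restricts to $\mathcal E_d|_U\cong U\times\mathcal H_d$). 3. For every compatible smooth connection $\nabla$ on $\mathcal E$, the formula $(\Pi_d\nabla)_X\tau:=\Pi_d(\nabla_X\tau)$, for sections $\tau$ of $\mathcal E_d\subset\mathcal E$, defines a compatible smooth connection $\Pi_d\nabla$ on $\mathcal E_d$. -/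

import Mathlib

open Bundle
open scoped Manifold ContDiff Topology

noncomputable section

section OrthogonalBasis

variable {H : Type*} [NormedAddCommGroup H] [InnerProductSpace ℝ H]

/-- `e₀, e₁, …` is an orthogonal basis of the Hilbert space `H`: nonzero, pairwise orthogonal
vectors (not necessarily of norm one) whose linear span is dense. Such a space is separable and
infinite-dimensional. -/
structure IsOrthogonalBasis (e : ℕ → H) : Prop where
  ne_zero : ∀ i, e i ≠ 0
  orthogonal : Pairwise fun i j => inner ℝ (e i) (e j) = 0
  dense_span : (Submodule.span ℝ (Set.range e)).topologicalClosure = ⊤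

/-- `H_d`, the span of the first `d` vectors. -/
def initialSpan (e : ℕ → H) (d : ℕ) : Submodule ℝ H :=
  Submodule.span ℝ (e '' Set.Iio d)

instance initialSpan.finiteDimensional (e : ℕ → H) (d : ℕ) :
    FiniteDimensional ℝ (initialSpan e d) :=
  FiniteDimensional.span_of_finite ℝ ((Set.finite_Iio d).image e)

end OrthogonalBasis

section Bundles

variable {EM : Type*} [NormedAddCommGroup EM] [NormedSpace ℝ EM]
  {HM : Type*} [TopologicalSpace HM] (I : ModelWithCorners ℝ EM HM)
  {M : Type*} [TopologicalSpace M] [ChartedSpace HM M]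
  (F : Type*) [NormedAddCommGroup F] [NormedSpace ℝ F]
  (E : M → Type*) [TopologicalSpace (TotalSpace F E)]
  [∀ x, NormedAddCommGroup (E x)] [∀ x, InnerProductSpace ℝ (E x)]
  [FiberBundle F E] [VectorBundle ℝ F E]

/-- A smooth subbundle with generic fiber `F'` of a bundle `E` with inner products on the fibers:
a family of linear subspaces of the fibers which, with the inherited inner products, is itself
a smooth vector bundle with a smooth metric, and whose inclusion into `E` is smooth. -/
structure SmoothSubbundle (F' : Type*) [NormedAddCommGroup F'] [NormedSpace ℝ F'] where
  /-- The fiber over `x`, a subspace of `E x`. -/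
  fiber : ∀ x : M, Submodule ℝ (E x)
  /-- The topology of the total space. -/
  topologicalSpaceTotal : TopologicalSpace (TotalSpace F' fun x => fiber x)
  /-- The fiber bundle structure, with model fiber `F'`. -/
  fiberBundle : FiberBundle F' fun x => fiber x
  vectorBundle : VectorBundle ℝ F' fun x => fiber x
  contMDiffVectorBundle : ContMDiffVectorBundle ∞ F' (fun x => fiber x) I
  isContMDiffRiemannianBundle : IsContMDiffRiemannianBundle I ∞ F' fun x => fiber x
  contMDiff_inclusion : ContMDiff (I.prod 𝓘(ℝ, F')) (I.prod 𝓘(ℝ, F)) ∞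
    fun p : TotalSpace F' (fun x => fiber x) => (⟨p.proj, (p.snd : E p.proj)⟩ : TotalSpace F E)

attribute [instance] SmoothSubbundle.topologicalSpaceTotal SmoothSubbundle.fiberBundle
  SmoothSubbundle.vectorBundle SmoothSubbundle.contMDiffVectorBundle
  SmoothSubbundle.isContMDiffRiemannianBundle

variable {I F E}

/-- A connection `∇` is compatible with the inner products of the fibers if
`X⟨σ, τ⟩ = ⟨∇_X σ, τ⟩ + ⟨σ, ∇_X τ⟩` for all smooth vector fields `X` and smooth sections
`σ`, `τ`. Here `cov σ x (X x)` is `(∇_X σ)(x)`. -/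
def CovariantDerivative.IsCompatible [IsManifold I 1 M] (cov : CovariantDerivative I F E) : Prop :=
  ∀ (X : ∀ x : M, TangentSpace I x) (σ τ : ∀ x, E x),
    ContMDiff I (I.prod 𝓘(ℝ, EM)) ∞ (fun x => (⟨x, X x⟩ : TangentBundle I M)) →
    ContMDiff I (I.prod 𝓘(ℝ, F)) ∞ (fun x => (⟨x, σ x⟩ : TotalSpace F E)) →
    ContMDiff I (I.prod 𝓘(ℝ, F)) ∞ (fun x => (⟨x, τ x⟩ : TotalSpace F E)) →
    ∀ x, mvfderiv I (fun y => inner ℝ (σ y) (τ y)) x (X x) =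
      inner ℝ (cov σ x (X x)) (τ x) + inner ℝ (σ x) (cov τ x (X x))

namespace SmoothSubbundle

variable {F' : Type*} [NormedAddCommGroup F'] [NormedSpace ℝ F'] [FiniteDimensional ℝ F']
  (S : SmoothSubbundle I F E F')

instance finiteDimensional_fiber (x : M) : FiniteDimensional ℝ (S.fiber x) :=
  ((trivializationAt F' (fun x => S.fiber x) x).continuousLinearEquivAt ℝ x
    (FiberBundle.mem_baseSet_trivializationAt' x)).symm.toLinearEquiv.finiteDimensional

/-- The fiberwise orthogonal projection `Π : E → S`, as a map of total spaces. -/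
def projection (p : TotalSpace F E) : TotalSpace F' fun x => S.fiber x :=
  ⟨p.proj, (S.fiber p.proj).orthogonalProjectionOnto p.snd⟩

/-- `Π∇`: apply `∇` to a section of the subbundle, seen as a section of `E`, and project the result
orthogonally to the subbundle. -/
def compress (cov : CovariantDerivative I F E) (τ : ∀ x, S.fiber x) (x : M) :
    TangentSpace I x →L[ℝ] S.fiber x :=
  (S.fiber x).orthogonalProjectionOnto ∘L cov (fun y => (τ y : E y)) x

end SmoothSubbundle

end Bundles

section Straightening

variable {EM : Type*} [NormedAddCommGroup EM] [NormedSpace ℝ EM]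
  {HM : Type*} [TopologicalSpace HM] {I : ModelWithCorners ℝ EM HM}
  {M : Type*} [TopologicalSpace M] [ChartedSpace HM M]
  {H : Type*} [NormedAddCommGroup H] [InnerProductSpace ℝ H]
  {E : M → Type*} [TopologicalSpace (TotalSpace H E)]
  [∀ x, NormedAddCommGroup (E x)] [∀ x, InnerProductSpace ℝ (E x)]
  [FiberBundle H E] [VectorBundle ℝ H E]

/-- Near every point there is a smooth linear local trivialization `E|_U ≅ U × H` in which the
orthogonal projection of the fibers of `E` onto those of `S` is the orthogonal projection
of `H` onto `K` (so that it restricts to `S|_U ≅ U × K`). -/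
def SmoothSubbundle.IsLocallyModelledOn (K : Submodule ℝ H) [FiniteDimensional ℝ K]
    (S : SmoothSubbundle I H E K) : Prop :=
  ∀ p : M, ∃ φ : Trivialization H (π H E), p ∈ φ.baseSet ∧ φ.IsLinear ℝ ∧
    ContMDiffOn (I.prod 𝓘(ℝ, H)) (I.prod 𝓘(ℝ, H)) ∞ φ φ.source ∧
    ContMDiffOn (I.prod 𝓘(ℝ, H)) (I.prod 𝓘(ℝ, H)) ∞ φ.toOpenPartialHomeomorph.symm φ.target ∧
    ∀ x ∈ φ.baseSet, ∀ v : E x,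
      (φ ⟨x, ((S.fiber x).orthogonalProjectionOnto v : E x)⟩).2 =
        (K.orthogonalProjectionOnto (φ ⟨x, v⟩).2 : H)

end Straightening

end

/-! The heart is a sequence of smooth global sections forming an orthonormal basis of every fiber
(`exists_orthonormal_sections`); the subbundle of rank `d` is spanned by the first `d` of them.
Compactness of the base yields a smooth family of linear surjections `Φ x` from one Banach space
`W`, a finite power of the model fiber, onto the fibers (`exists_spanning_family`). For a
finite-dimensional `U ⊆ W`, the parameters `c` with `Φ x c ∈ Φ x U` for some `x` form a meagre set:
a countable union of closed sets, each with empty interior because bad displacements in one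
coordinate of `W` lie in a compact subset of an infinite-dimensional space. So a dense sequence in
`W` can be chosen recursively with images linearly independent in every fiber. Their span is dense
since `Φ x` is surjective, and Gram–Schmidt makes them orthonormal.

In such a frame the projection is the finite sum `∑ ⟨s i, v⟩ s i`, hence smooth, also after
composition with a connection; compatibility survives because pairing with a section of the
subbundle does not see the projection. The infinite frame is not claimed to vary smoothly in
operator norm, so the local models use it only at one point: an isometry there is extended nearby
and corrected by finitely many sections (`SmoothSubbundle.isLocallyModelledOn_ofOrthonormalFrame`).
-/

noncomputable section

/-! ### Smooth maps into the total space of a vector bundle -/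

section BundleMaps

variable {EM : Type*} [NormedAddCommGroup EM] [NormedSpace ℝ EM]
  {HM : Type*} [TopologicalSpace HM] {I : ModelWithCorners ℝ EM HM}
  {M : Type*} [TopologicalSpace M] [ChartedSpace HM M]
  {F : Type*} [NormedAddCommGroup F] [NormedSpace ℝ F]
  {E : M → Type*} [TopologicalSpace (TotalSpace F E)]
  [∀ x, TopologicalSpace (E x)] [∀ x, AddCommGroup (E x)] [∀ x, Module ℝ (E x)]
  [FiberBundle F E] [VectorBundle ℝ F E]
  {EN : Type*} [NormedAddCommGroup EN] [NormedSpace ℝ EN]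
  {HN : Type*} [TopologicalSpace HN] {J : ModelWithCorners ℝ EN HN}
  {N : Type*} [TopologicalSpace N] [ChartedSpace HN N]
  {n : WithTop ℕ∞} {b : N → M} {y₀ : N}

/-- The base point moves along `b` because the families used below live over `F × M` or over a total
space, not only over `M`. -/
theorem ContMDiffAt.smul_bundle {f : N → ℝ} {v : ∀ y, E (b y)}
    (hf : ContMDiffAt J 𝓘(ℝ, ℝ) n f y₀)
    (hv : ContMDiffAt J (I.prod 𝓘(ℝ, F)) n (fun y => (⟨b y, v y⟩ : TotalSpace F E)) y₀) :
    ContMDiffAt J (I.prod 𝓘(ℝ, F)) n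
      (fun y => (⟨b y, f y • v y⟩ : TotalSpace F E)) y₀ := by
  rw [contMDiffAt_totalSpace] at hv ⊢
  refine ⟨hv.1, (hf.smul hv.2).congr_of_eventuallyEq ?_⟩
  filter_upwards [hv.1.continuousAt.preimage_mem_nhds
    ((trivializationAt F E (b y₀)).open_baseSet.mem_nhds
      (FiberBundle.mem_baseSet_trivializationAt' (b y₀)))] with y hy
  exact ((trivializationAt F E (b y₀)).linear ℝ hy).map_smul _ _

theorem ContMDiffAt.sum_bundle {κ : Type*} (s : Finset κ) {v : κ → ∀ y, E (b y)}
    (hb : ContMDiffAt J I n b y₀)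
    (hv : ∀ i ∈ s,
      ContMDiffAt J (I.prod 𝓘(ℝ, F)) n (fun y => (⟨b y, v i y⟩ : TotalSpace F E)) y₀) :
    ContMDiffAt J (I.prod 𝓘(ℝ, F)) n
      (fun y => (⟨b y, ∑ i ∈ s, v i y⟩ : TotalSpace F E)) y₀ := by
  simp only [contMDiffAt_totalSpace] at hv ⊢
  refine ⟨hb, (ContMDiffAt.sum (fun i hi => (hv i hi).2)).congr_of_eventuallyEq ?_⟩
  filter_upwards [hb.continuousAt.preimage_mem_nhds
    ((trivializationAt F E (b y₀)).open_baseSet.mem_nhds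
      (FiberBundle.mem_baseSet_trivializationAt' (b y₀)))] with y hy
  exact map_sum (((trivializationAt F E (b y₀)).linear ℝ hy).mk' _) _ _

/-- Cutting off the inverse of a trivialization by a function supported in the base set gives
a map which is smooth everywhere. -/
theorem Bundle.Trivialization.contMDiff_smul_symm [ContMDiffVectorBundle n F E I]
    (ψ : Trivialization F (π F E)) [MemTrivializationAtlas ψ] {f : M → ℝ}
    (hf : ContMDiff I 𝓘(ℝ, ℝ) n f) (hsupp : tsupport f ⊆ ψ.baseSet) :
    ContMDiff (𝓘(ℝ, F).prod I) (I.prod 𝓘(ℝ, F)) n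
      (fun q : F × M => (⟨q.2, f q.2 • ψ.symm q.2 q.1⟩ : TotalSpace F E)) := by
  intro q
  by_cases hq : q.2 ∈ ψ.baseSet
  · refine ContMDiffAt.smul_bundle (hf.contMDiffAt.comp q contMDiffAt_snd) ?_
    have h1 : ContMDiffAt (I.prod 𝓘(ℝ, F)) (I.prod 𝓘(ℝ, F)) n
        ψ.toOpenPartialHomeomorph.symm (q.2, q.1) :=
      ψ.contMDiffOn_symm.contMDiffAt
        (ψ.open_target.mem_nhds (ψ.mem_target.2 hq))
    have h2 : ContMDiffAt (𝓘(ℝ, F).prod I) (I.prod 𝓘(ℝ, F)) n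
        (fun q : F × M => (q.2, q.1)) q := contMDiffAt_snd.prodMk contMDiffAt_fst
    refine (ContMDiffAt.comp q h1 h2).congr_of_eventuallyEq ?_
    filter_upwards [continuous_snd.continuousAt.preimage_mem_nhds
      (ψ.open_baseSet.mem_nhds hq)] with q' hq'
    exact ψ.mk_symm hq' q'.1
  · have hq' : q.2 ∉ tsupport f := fun h => hq (hsupp h)
    refine ((contMDiff_zeroSection ℝ E (F := F)).contMDiffAt.comp q
      contMDiffAt_snd).congr_of_eventuallyEq ?_
    filter_upwards [continuous_snd.continuousAt.preimage_mem_nhds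
      ((isClosed_tsupport f).isOpen_compl.mem_nhds hq')] with q' h'
    have : f q'.2 = 0 := image_eq_zero_of_notMem_tsupport h'
    simp [this, zeroSection]

end BundleMaps

/-! ### A finite-parameter-block family spanning every fiber -/

section SpanningFamily

variable {EM : Type*} [NormedAddCommGroup EM] [NormedSpace ℝ EM] [FiniteDimensional ℝ EM]
  {HM : Type*} [TopologicalSpace HM] (I : ModelWithCorners ℝ EM HM)
  {M : Type*} [TopologicalSpace M] [ChartedSpace HM M] [IsManifold I ∞ M]
  [CompactSpace M] [T2Space M]
  (F : Type*) [NormedAddCommGroup F] [NormedSpace ℝ F]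
  (E : M → Type*) [TopologicalSpace (TotalSpace F E)]
  [∀ x, TopologicalSpace (E x)] [∀ x, AddCommGroup (E x)] [∀ x, Module ℝ (E x)]
  [FiberBundle F E] [VectorBundle ℝ F E] [ContMDiffVectorBundle ∞ F E I]

/-- Over a compact manifold there is a smooth family of sections, depending linearly on a
parameter in a finite power of the model fiber, which contains over each member of a finite closed
cover all sections that are constant in a trivialization. -/
theorem exists_spanning_family [DecidableEq M] :
    ∃ (t : Finset M) (Φ : ∀ x, (t → F) →ₗ[ℝ] E x)
      (K : t → Set M) (ψ : t → Trivialization F (π F E)),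
      ContMDiff (𝓘(ℝ, t → F).prod I) (I.prod 𝓘(ℝ, F)) ∞
        (fun q : (t → F) × M => (⟨q.2, Φ q.2 q.1⟩ : TotalSpace F E)) ∧
      (∀ i, IsClosed (K i)) ∧ (∀ x, ∃ i, x ∈ K i) ∧ (∀ i, K i ⊆ (ψ i).baseSet) ∧
      (∀ i, (ψ i).IsLinear ℝ) ∧
      ∀ i, ∀ x ∈ K i, ∀ h, (ψ i ⟨x, Φ x (Pi.single i h)⟩).2 = h := by
  have bump : ∀ p : M, ∃ f : M → ℝ, ContMDiff I 𝓘(ℝ, ℝ) ∞ f ∧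
      tsupport f ⊆ (trivializationAt F E p).baseSet ∧ ∀ᶠ x in 𝓝 p, f x = 1 := fun p => by
    obtain ⟨f, -, hf⟩ := (SmoothBumpFunction.nhds_basis_tsupport (I := I) p).mem_iff.1
      ((trivializationAt F E p).open_baseSet.mem_nhds
        (FiberBundle.mem_baseSet_trivializationAt' p))
    exact ⟨f, f.contMDiff, hf, f.eventuallyEq_one⟩
  choose f hf hsupp hone using bump
  obtain ⟨t, -, ht⟩ := isCompact_univ.elim_nhds_subcover (fun p => {x | f p x = 1})
    (fun p _ => hone p)
  let T : ∀ p : M, Trivialization F (π F E) := fun p => trivializationAt F E p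
  have hT : ∀ p, T p = trivializationAt F E p := fun p => rfl
  have hmem : ∀ p x, f p x ≠ 0 → x ∈ (T p).baseSet := fun p x hx =>
    hsupp p (subset_tsupport _ hx)
  refine ⟨t,
    -- Slot `i` goes through the inverse of the `i`-th trivialization, cut off by its bump function.
    -- The bumps are not normalized to sum to one: on `K i = {f i = 1}` slot `i` must come back
    -- unchanged.
    fun x => ∑ i : t, f i.1 x • ((T i.1).symmₗ ℝ x ∘ₗ LinearMap.proj i),
    fun i => {x | f i.1 x = 1}, fun i => T i.1, ?_, ?_, ?_, ?_, ?_, ?_⟩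
  · intro q
    simp only [LinearMap.sum_apply, LinearMap.smul_apply, LinearMap.comp_apply,
      LinearMap.proj_apply]
    refine ContMDiffAt.sum_bundle _ contMDiffAt_snd fun i _ => ?_
    have h1 := (T i.1).contMDiff_smul_symm (n := ∞) (hf i.1) (hsupp i.1)
    have h2 : ContMDiff (𝓘(ℝ, t → F).prod I) (𝓘(ℝ, F).prod I) ∞
        (fun q : (t → F) × M => (q.1 i, q.2)) := by
      refine ContMDiff.prodMk ?_ contMDiff_snd
      exact (ContinuousLinearMap.proj (R := ℝ) (φ := fun _ : t => F) i).contMDiff.comp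
        contMDiff_fst
    refine ((h1.comp h2).contMDiffAt).congr_of_eventuallyEq (.of_forall fun q => ?_)
    by_cases h : f i.1 q.2 = 0
    · simp [h]
    · simp [hmem _ _ h]
  · exact fun i => isClosed_eq (hf i.1).continuous continuous_const
  · intro x
    obtain ⟨p, hp⟩ := Set.mem_iUnion.1 (ht (Set.mem_univ x))
    obtain ⟨hp, hx⟩ := Set.mem_iUnion.1 hp
    exact ⟨⟨_, hp⟩, hx⟩
  · intro i x hx
    exact hmem _ _ (by rw [show f i.1 x = 1 from hx]; exact one_ne_zero)
  · intro i
    infer_instance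
  · intro i x hx h
    have hb : x ∈ (T i.1).baseSet := hmem _ _ (by rw [show f i.1 x = 1 from hx]; exact one_ne_zero)
    have : (∑ j : t, f j.1 x • ((T j.1).symmₗ ℝ x ∘ₗ LinearMap.proj j)) (Pi.single i h)
        = (T i.1).symm x h := by
      rw [LinearMap.sum_apply, Finset.sum_eq_single i]
      · simp [show f i.1 x = 1 from hx, hb]
      · intro j _ hj
        simp [Pi.single_eq_of_ne hj]
      · simp
    rw [this, (T i.1).apply_mk_symm hb]

end SpanningFamily

/-! ### Generic parameters: the Baire argument -/

section GenericSections

/-- Riesz's theorem: a compact closed ball forces finite dimension. -/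
theorem IsCompact.interior_eq_empty_of_infinite_dimensional {F : Type*} [NormedAddCommGroup F]
    [NormedSpace ℝ F] (hF : ¬ FiniteDimensional ℝ F) {T : Set F} (hT : IsCompact T) :
    interior T = ∅ := by
  rw [Set.eq_empty_iff_forall_notMem]
  intro x hx
  obtain ⟨r, hr, hball⟩ := Metric.nhds_basis_closedBall.mem_iff.1 (mem_interior_iff_mem_nhds.1 hx)
  exact hF (.of_isCompact_closedBall ℝ hr (hT.of_isClosed_subset Metric.isClosed_closedBall hball))

theorem continuous_sub_family {M F W : Type*} [TopologicalSpace M] {E : M → Type*}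
    [TopologicalSpace (TotalSpace F E)] [∀ x, AddCommGroup (E x)] [∀ x, Module ℝ (E x)]
    [NormedAddCommGroup W] [NormedSpace ℝ W] {Φ : ∀ x, W →ₗ[ℝ] E x}
    (hΦ : Continuous (fun q : W × M => (⟨q.2, Φ q.2 q.1⟩ : TotalSpace F E))) :
    Continuous (fun q : W × M × W => (⟨q.2.1, Φ q.2.1 (q.1 - q.2.2)⟩ : TotalSpace F E)) :=
  hΦ.comp (f := fun q : W × M × W => (q.1 - q.2.2, q.2.1)) (by fun_prop)

variable {M : Type*} [TopologicalSpace M]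
  {F : Type*} [NormedAddCommGroup F] [NormedSpace ℝ F]
  {E : M → Type*} [TopologicalSpace (TotalSpace F E)]
  [∀ x, NormedAddCommGroup (E x)] [∀ x, InnerProductSpace ℝ (E x)]
  {ι : Type*} [Fintype ι] [DecidableEq ι] {Φ : ∀ x, (ι → F) →ₗ[ℝ] E x}

/-- Move `c` only in slot `i`, by `h`. Over `K` the trivialization recovers `h`, so `c + h` is bad
only if `h = -ψ (Φ x (c - u))` for some `(x, u) ∈ K × C`. These values form a compact set, which
cannot contain a neighbourhood of `0`. -/
theorem interior_setOf_exists_family_sub_eq_zero (hF : ¬ FiniteDimensional ℝ F)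
    (hΦ : Continuous (fun q : (ι → F) × M => (⟨q.2, Φ q.2 q.1⟩ : TotalSpace F E)))
    {ψ : Trivialization F (π F E)} [ψ.IsLinear ℝ] {K : Set M} (hK : IsCompact K)
    (hKψ : K ⊆ ψ.baseSet) (i : ι) (hΦψ : ∀ x ∈ K, ∀ h, (ψ ⟨x, Φ x (Pi.single i h)⟩).2 = h)
    {C : Set (ι → F)} (hC : IsCompact C) :
    interior {c | ∃ x ∈ K, ∃ u ∈ C, Φ x (c - u) = 0} = ∅ := by
  rw [Set.eq_empty_iff_forall_notMem]
  intro c hc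
  let T : Set F := (fun q : M × (ι → F) => -(ψ ⟨q.1, Φ q.1 (c - q.2)⟩).2) '' (K ×ˢ C)
  have hT : IsCompact T := by
    refine (hK.prod hC).image_of_continuousOn (ContinuousOn.neg ?_)
    refine continuous_snd.comp_continuousOn (ψ.continuousOn.comp ?_ ?_)
    · exact ((continuous_sub_family hΦ).comp
        (f := fun q : M × (ι → F) => (c, q)) (by fun_prop)).continuousOn
    · rintro ⟨x, u⟩ ⟨hx, -⟩
      exact ψ.mem_source.2 (hKψ hx)
  have h0 : (fun h : F => c + Pi.single i h) ⁻¹'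
      (interior {c | ∃ x ∈ K, ∃ u ∈ C, Φ x (c - u) = 0}) ⊆ T := by
    intro h hh
    obtain ⟨x, hx, u, hu, hxu⟩ := interior_subset hh
    refine ⟨(x, u), ⟨hx, hu⟩, ?_⟩
    have hlin := (ψ.linear ℝ (hKψ hx))
    have h1 : Φ x (Pi.single i h) = - Φ x (c - u) := by
      rw [eq_neg_iff_add_eq_zero, ← map_add, ← hxu]
      refine congrArg (Φ x) ?_
      rw [← add_sub_assoc]
      exact congrArg (· - u) (add_comm _ _)
    have h2 := hΦψ x hx h
    rw [h1, hlin.map_neg] at h2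
    exact h2
  have hcont : Continuous fun h : F => c + Pi.single i h :=
    continuous_const.add (continuous_single (A := fun _ : ι => F) i)
  have h1 : (0 : F) ∈ interior T := interior_maximal h0 (isOpen_interior.preimage hcont)
    (by simpa using hc)
  rw [hT.interior_eq_empty_of_infinite_dimensional hF] at h1
  exact h1

variable [FiberBundle F E] [VectorBundle ℝ F E] [IsContinuousRiemannianBundle F E]

/-- The continuous metric turns vanishing in a varying fiber into the zero set of a real function,
and projection along the compact factor `K × C` is a closed map. -/
theorem isClosed_setOf_exists_family_sub_eq_zero {W : Type*} [NormedAddCommGroup W]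
    [NormedSpace ℝ W] {Φ : ∀ x, W →ₗ[ℝ] E x}
    (hΦ : Continuous (fun q : W × M => (⟨q.2, Φ q.2 q.1⟩ : TotalSpace F E)))
    {K : Set M} (hK : IsCompact K) {C : Set W} (hC : IsCompact C) :
    IsClosed {c | ∃ x ∈ K, ∃ u ∈ C, Φ x (c - u) = 0} := by
  have : CompactSpace (K ×ˢ C : Set (M × W)) := isCompact_iff_compactSpace.1 (hK.prod hC)
  have hcont : Continuous fun q : W × (K ×ˢ C : Set (M × W)) =>
      inner ℝ (Φ q.2.1.1 (q.1 - q.2.1.2)) (Φ q.2.1.1 (q.1 - q.2.1.2)) := by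
    have h := (continuous_sub_family hΦ).comp
      (f := fun q : W × (K ×ˢ C : Set (M × W)) => (q.1, q.2.1)) (by fun_prop)
    exact Continuous.inner_bundle (F := F) (E := E) h h
  have hcl := isClosedMap_fst_of_compactSpace (X := W) (Y := (K ×ˢ C : Set (M × W))) _
    (isClosed_eq hcont (continuous_const (y := (0 : ℝ))))
  convert hcl using 1
  ext c
  simp only [Set.mem_ofPred_eq, Set.mem_image, inner_self_eq_zero, Prod.exists]
  constructor
  · rintro ⟨x, hx, u, hu, h⟩
    exact ⟨c, ⟨(x, u), hx, hu⟩, h, rfl⟩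
  · rintro ⟨c', ⟨⟨x, u⟩, hx, hu⟩, h, rfl⟩
    exact ⟨x, hx, u, hu, h⟩

/-- For a generic parameter, the section given by the family avoids everywhere the image of
a given finite-dimensional space of parameters. -/
theorem dense_setOf_forall_family_notMem_map [CompactSpace M] [CompleteSpace F]
    (hF : ¬ FiniteDimensional ℝ F)
    (hΦ : Continuous (fun q : (ι → F) × M => (⟨q.2, Φ q.2 q.1⟩ : TotalSpace F E)))
    {K : ι → Set M} {ψ : ι → Trivialization F (π F E)} (hK : ∀ i, IsClosed (K i))
    (hKu : ∀ x, ∃ i, x ∈ K i) (hKψ : ∀ i, K i ⊆ (ψ i).baseSet) (hψ : ∀ i, (ψ i).IsLinear ℝ)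
    (hΦψ : ∀ i, ∀ x ∈ K i, ∀ h, (ψ i ⟨x, Φ x (Pi.single i h)⟩).2 = h)
    (U : Submodule ℝ (ι → F)) [FiniteDimensional ℝ U] :
    Dense {c | ∀ x, Φ x c ∉ U.map (Φ x)} := by
  -- Exhausting `U` by compact balls and `M` by the finitely many `K i` leaves countably many bad
  -- sets, as Baire requires.
  let C : ℕ → Set (ι → F) := fun k => Subtype.val '' Metric.closedBall (0 : U) k
  have : ProperSpace U := FiniteDimensional.proper ℝ U
  have hC : ∀ k, IsCompact (C k) := fun k =>
    (isCompact_closedBall (0 : U) k).image continuous_subtype_val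
  let B : ι × ℕ → Set (ι → F) := fun q => {c | ∃ x ∈ K q.1, ∃ u ∈ C q.2, Φ x (c - u) = 0}
  have hB : Dense (⋂ q, (B q)ᶜ) := by
    refine dense_iInter_of_isOpen (fun q => ?_) fun q => ?_
    · exact (isClosed_setOf_exists_family_sub_eq_zero hΦ (hK q.1).isCompact (hC q.2)).isOpen_compl
    · have := hψ q.1
      exact interior_eq_empty_iff_dense_compl.1
        (interior_setOf_exists_family_sub_eq_zero hF hΦ (hK q.1).isCompact (hKψ q.1) q.1
          (hΦψ q.1) (hC q.2))
  refine hB.mono fun c hc x => ?_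
  rintro ⟨u, hu, hux⟩
  obtain ⟨i, hi⟩ := hKu x
  obtain ⟨k, hk⟩ := exists_nat_ge ‖(⟨u, hu⟩ : U)‖
  refine Set.mem_iInter.1 hc (i, k) ⟨x, hi, u, ⟨⟨u, hu⟩, by simpa using hk, rfl⟩, ?_⟩
  rw [map_sub, hux, sub_self]

/-- In a separable space a dense sequence can be chosen so that every term is taken from a dense
set depending on the span of the preceding terms. -/
theorem exists_denseRange_forall_mem_of_dense {W : Type*} [NormedAddCommGroup W] [NormedSpace ℝ W]
    [TopologicalSpace.SeparableSpace W] (G : Submodule ℝ W → Set W)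
    (hG : ∀ U : Submodule ℝ W, FiniteDimensional ℝ U → Dense (G U)) :
    ∃ c : ℕ → W, DenseRange c ∧ ∀ n, c n ∈ G (Submodule.span ℝ (c '' Set.Iio n)) := by
  -- Through `Nat.unpair`, each point of a dense sequence is a target infinitely often, at stage `n`
  -- with error below `1 / (n + 1)`. Hence the chosen points remain dense.
  have step : ∀ (n : ℕ) (s : Finset W), ∃ c ∈ G (Submodule.span ℝ (s : Set W)),
      dist (TopologicalSpace.denseSeq W n.unpair.1) c < 1 / ((n : ℝ) + 1) := fun n s =>
    (hG _ (FiniteDimensional.span_finset ℝ s)).exists_dist_lt _ (by positivity)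
  classical
  choose f hf hd using step
  let c : ℕ → W := fun n => Nat.strongRec (motive := fun _ => W)
    (fun n ih => f n (Finset.univ.image fun j : Fin n => ih j.1 j.2)) n
  have hc : ∀ n, c n = f n (Finset.univ.image fun j : Fin n => c j.1) := fun n => by
    simp only [c]
    rw [Nat.strongRec_eq]
  have himage : ∀ n, ((Finset.univ.image fun j : Fin n => c j.1 : Finset W) : Set W)
      = c '' Set.Iio n := fun n => by
    ext w
    simp only [Finset.coe_image, Finset.coe_univ, Set.image_univ, Set.mem_range, Set.mem_image,
      Set.mem_Iio]
    exact ⟨fun ⟨j, hj⟩ => ⟨j.1, j.2, hj⟩, fun ⟨j, hj, h⟩ => ⟨⟨j, hj⟩, h⟩⟩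
  refine ⟨c, ?_, fun n => ?_⟩
  · rw [Metric.denseRange_iff]
    intro w r hr
    obtain ⟨k, hk⟩ := Metric.denseRange_iff.1 (TopologicalSpace.denseRange_denseSeq W) w (r / 2)
      (half_pos hr)
    obtain ⟨l, hl⟩ := exists_nat_one_div_lt (half_pos hr)
    refine ⟨Nat.pair k l, ?_⟩
    have h1 := hd (Nat.pair k l) (Finset.univ.image fun j : Fin (Nat.pair k l) => c j.1)
    rw [← hc, Nat.unpair_pair] at h1
    have h2 : 1 / (((Nat.pair k l : ℕ) : ℝ) + 1) ≤ 1 / ((l : ℝ) + 1) := by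
      gcongr
      exact Nat.right_le_pair k l
    calc dist w (c (Nat.pair k l)) ≤ _ := dist_triangle _ (TopologicalSpace.denseSeq W k) _
      _ < r := by linarith
  · rw [← himage, hc n]
    exact hf _ _

end GenericSections

/-! ### Orthogonal bases and linear independence of sequences -/

section OrthogonalBasisFacts

variable {H : Type*} [NormedAddCommGroup H] [InnerProductSpace ℝ H] {e : ℕ → H}

theorem IsOrthogonalBasis.linearIndependent (he : IsOrthogonalBasis e) : LinearIndependent ℝ e :=
  linearIndependent_of_ne_zero_of_inner_eq_zero he.ne_zero he.orthogonal

theorem IsOrthogonalBasis.not_finiteDimensional (he : IsOrthogonalBasis e) :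
    ¬ FiniteDimensional ℝ H := fun _ =>
  have := he.linearIndependent.finite
  not_finite ℕ

theorem IsOrthogonalBasis.separableSpace (he : IsOrthogonalBasis e) :
    TopologicalSpace.SeparableSpace H := by
  have h := (Set.countable_range e).isSeparable.span (R := ℝ)
  rw [← TopologicalSpace.isSeparable_univ_iff]
  have h2 := h.closure
  rwa [← Submodule.topologicalClosure_coe, he.dense_span] at h2

/-- The vectors of an orthogonal basis, normalized. -/
def IsOrthogonalBasis.normalized (e : ℕ → H) (n : ℕ) : H := ‖e n‖⁻¹ • e n

theorem IsOrthogonalBasis.orthonormal_normalized (he : IsOrthogonalBasis e) :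
    Orthonormal ℝ (normalized e) := by
  refine ⟨fun n => ?_, fun i j hij => ?_⟩
  · rw [normalized, norm_smul, norm_inv, norm_norm,
      inv_mul_cancel₀ (norm_ne_zero_iff.2 (he.ne_zero n))]
  · simp only [normalized, inner_smul_left, inner_smul_right]
    rw [he.orthogonal hij]
    simp

theorem IsOrthogonalBasis.span_normalized_image (he : IsOrthogonalBasis e) (s : Set ℕ) :
    Submodule.span ℝ (normalized e '' s) = Submodule.span ℝ (e '' s) := by
  refine le_antisymm (Submodule.span_le.2 ?_) (Submodule.span_le.2 ?_)
  · rintro _ ⟨n, hn, rfl⟩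
    exact Submodule.smul_mem _ _ (Submodule.subset_span ⟨n, hn, rfl⟩)
  · rintro _ ⟨n, hn, rfl⟩
    have : e n = ‖e n‖ • normalized e n := by
      rw [normalized, smul_smul, mul_inv_cancel₀ (norm_ne_zero_iff.2 (he.ne_zero n)), one_smul]
    rw [this]
    exact Submodule.smul_mem _ _ (Submodule.subset_span ⟨n, hn, rfl⟩)

/-- Any finite set of indices lies in an initial segment, and initial segments follow by adding one
vector at a time. -/
theorem linearIndependent_of_notMem_span_image_Iio {V : Type*} [AddCommGroup V] [Module ℝ V]
    {v : ℕ → V} (h : ∀ n, v n ∉ Submodule.span ℝ (v '' Set.Iio n)) : LinearIndependent ℝ v := by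
  rw [linearIndependent_iff_finset_linearIndependent (R := ℝ)]
  intro s
  refine LinearIndependent.comp (R := ℝ) (ι := Fin (s.sup id + 1))
    (v := fun i => v i) ?_ (fun i => ⟨i.1, Nat.lt_succ_of_le (Finset.le_sup (f := id) i.2)⟩)
    (fun i j hij => Subtype.ext (congrArg Fin.val hij))
  generalize s.sup id + 1 = d
  induction d with
  | zero => exact linearIndependent_empty_type
  | succ d ih =>
    rw [linearIndependent_finSucc']
    refine ⟨ih, fun hmem => h d (Submodule.span_mono ?_ hmem)⟩
    rintro _ ⟨i, rfl⟩
    exact ⟨i, i.2, rfl⟩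

end OrthogonalBasisFacts

/-! ### Smooth Gram–Schmidt and the global orthonormal frame -/

section OrthonormalSections

variable {EM : Type*} [NormedAddCommGroup EM] [NormedSpace ℝ EM]
  {HM : Type*} [TopologicalSpace HM] {I : ModelWithCorners ℝ EM HM}
  {M : Type*} [TopologicalSpace M] [ChartedSpace HM M]
  {F : Type*} [NormedAddCommGroup F] [NormedSpace ℝ F]
  {E : M → Type*} [TopologicalSpace (TotalSpace F E)]
  [∀ x, NormedAddCommGroup (E x)] [∀ x, InnerProductSpace ℝ (E x)]
  [FiberBundle F E] [VectorBundle ℝ F E]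

open InnerProductSpace in
-- The recursion uses only metric pairings, sums and division by squared norms, which linear
-- independence keeps nonzero.
theorem contMDiff_gramSchmidt {n : WithTop ℕ∞} [IsContMDiffRiemannianBundle I n F E]
    {v : ℕ → ∀ x, E x}
    (hv : ∀ k, ContMDiff I (I.prod 𝓘(ℝ, F)) n (fun x => (⟨x, v k x⟩ : TotalSpace F E)))
    (hli : ∀ x, LinearIndependent ℝ fun k => v k x) (k : ℕ) :
    ContMDiff I (I.prod 𝓘(ℝ, F)) n
      (fun x => (⟨x, gramSchmidt ℝ (fun k => v k x) k⟩ : TotalSpace F E)) := by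
  induction k using Nat.strong_induction_on with
  | _ k ih =>
    have h : (fun x => gramSchmidt ℝ (fun k => v k x) k) =
        v k - fun x => ∑ i ∈ Finset.Iio k,
          (inner ℝ (gramSchmidt ℝ (fun k => v k x) i) (v k x) /
            inner ℝ (gramSchmidt ℝ (fun k => v k x) i) (gramSchmidt ℝ (fun k => v k x) i)) •
              gramSchmidt ℝ (fun k => v k x) i := by
      funext x
      rw [Pi.sub_apply, gramSchmidt_def]
      simp only [Submodule.starProjection_singleton, real_inner_self_eq_norm_sq]
      rfl
    have key := (hv k).sub_section (t := fun x => ∑ i ∈ Finset.Iio k,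
          (inner ℝ (gramSchmidt ℝ (fun k => v k x) i) (v k x) /
            inner ℝ (gramSchmidt ℝ (fun k => v k x) i) (gramSchmidt ℝ (fun k => v k x) i)) •
              gramSchmidt ℝ (fun k => v k x) i) fun x => by
      refine ContMDiffAt.sum_bundle (b := id) _ contMDiffAt_id fun i hi => ?_
      have hi := ih i (Finset.mem_Iio.1 hi)
      refine ContMDiffAt.smul_bundle (b := id) ?_ (hi x)
      refine ContMDiffAt.div₀ (hi.inner_bundle (hv k)).contMDiffAt
        (hi.inner_bundle hi).contMDiffAt ?_
      exact inner_self_ne_zero.2 (gramSchmidt_ne_zero _ (hli x))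
    rw [← h] at key
    exact key

open InnerProductSpace in
theorem contMDiff_gramSchmidtNormed {n : WithTop ℕ∞} [IsContMDiffRiemannianBundle I n F E]
    {v : ℕ → ∀ x, E x}
    (hv : ∀ k, ContMDiff I (I.prod 𝓘(ℝ, F)) n (fun x => (⟨x, v k x⟩ : TotalSpace F E)))
    (hli : ∀ x, LinearIndependent ℝ fun k => v k x) (k : ℕ) :
    ContMDiff I (I.prod 𝓘(ℝ, F)) n
      (fun x => (⟨x, gramSchmidtNormed ℝ (fun k => v k x) k⟩ : TotalSpace F E)) := fun x => by
  have h := contMDiff_gramSchmidt hv hli k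
  have hne : inner ℝ (gramSchmidt ℝ (fun k => v k x) k) (gramSchmidt ℝ (fun k => v k x) k) ≠ 0 :=
    inner_self_ne_zero.2 (gramSchmidt_ne_zero _ (hli x))
  have hsqrt : ContMDiffAt I 𝓘(ℝ, ℝ) n (fun x => (√(inner ℝ (gramSchmidt ℝ (fun k => v k x) k)
      (gramSchmidt ℝ (fun k => v k x) k)))⁻¹) x := by
    refine ContMDiffAt.inv₀ ?_ ?_
    · exact ((Real.contDiffAt_sqrt hne).contMDiffAt.comp x (h.inner_bundle h).contMDiffAt)
    · rw [← norm_eq_sqrt_real_inner]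
      exact norm_ne_zero_iff.2 (gramSchmidt_ne_zero _ (hli x))
  refine (ContMDiffAt.smul_bundle (b := id) hsqrt (h x)).congr_of_eventuallyEq
    (.of_forall fun y => ?_)
  simp only [id, gramSchmidtNormed, norm_eq_sqrt_real_inner]
  rfl

/-- A Hilbert bundle with infinite-dimensional separable fibers over a compact manifold has
a sequence of smooth sections which is an orthonormal basis of every fiber. -/
theorem exists_orthonormal_sections [FiniteDimensional ℝ EM] [IsManifold I ∞ M]
    [CompactSpace M] [T2Space M] [CompleteSpace F] [TopologicalSpace.SeparableSpace F]
    [ContMDiffVectorBundle ∞ F E I] [IsContMDiffRiemannianBundle I ∞ F E]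
    (hF : ¬ FiniteDimensional ℝ F) :
    ∃ s : ℕ → ∀ x, E x,
      (∀ k, ContMDiff I (I.prod 𝓘(ℝ, F)) ∞ (fun x => (⟨x, s k x⟩ : TotalSpace F E))) ∧
      (∀ x, Orthonormal ℝ fun k => s k x) ∧
      ∀ x, (Submodule.span ℝ (Set.range fun k => s k x)).topologicalClosure = ⊤ := by
  classical
  have hcont : IsContinuousRiemannianBundle F E := by
    obtain ⟨g, hg, hgi⟩ := ‹IsContMDiffRiemannianBundle I ∞ F E›.exists_contMDiff
    exact ⟨g, hg.continuous, hgi⟩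
  obtain ⟨t, Φ, K, ψ, hΦ, hK, hKu, hKψ, hψ, hΦψ⟩ := exists_spanning_family I F E
  have hgen := dense_setOf_forall_family_notMem_map (Φ := Φ) hF hΦ.continuous hK hKu hKψ hψ hΦψ
  obtain ⟨c, hcd, hc⟩ := exists_denseRange_forall_mem_of_dense
    (fun U : Submodule ℝ (t → F) => {c | ∀ x, Φ x c ∉ U.map (Φ x)}) fun U _ => hgen U
  have hv : ∀ k, ContMDiff I (I.prod 𝓘(ℝ, F)) ∞
      (fun x => (⟨x, Φ x (c k)⟩ : TotalSpace F E)) := fun k =>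
    hΦ.comp (f := fun x => (c k, x)) (contMDiff_const.prodMk contMDiff_id)
  -- One choice of `c k` works for all `x` at once, since the generic set already quantifies over
  -- the whole base.
  have hli : ∀ x, LinearIndependent ℝ fun k => Φ x (c k) := fun x => by
    refine linearIndependent_of_notMem_span_image_Iio fun k hk => hc k x ?_
    rw [Submodule.map_span, ← Set.image_comp]
    exact hk
  refine ⟨fun k x => InnerProductSpace.gramSchmidtNormed ℝ (fun k => Φ x (c k)) k,
    contMDiff_gramSchmidtNormed hv hli,
    fun x => InnerProductSpace.gramSchmidtNormed_orthonormal (hli x), fun x => ?_⟩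
  rw [InnerProductSpace.span_gramSchmidtNormed_range, InnerProductSpace.span_gramSchmidt,
    ← Submodule.dense_iff_topologicalClosure_eq_top]
  -- A single slot `i` with `x ∈ K i` already reaches the whole fiber; a continuous surjection then
  -- carries the dense sequence `c` to a dense one.
  have hsurj : Function.Surjective (Φ x) := fun w => by
    obtain ⟨i, hi⟩ := hKu x
    refine ⟨Pi.single i (ψ i ⟨x, w⟩).2, ?_⟩
    have := hψ i
    exact ((ψ i).linearEquivAt ℝ x (hKψ i hi)).injective (hΦψ i x hi _)
  have hΦx : Continuous (Φ x) := by
    rw [(FiberBundle.totalSpaceMk_isInducing F E x).continuous_iff]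
    exact hΦ.continuous.comp (f := fun w => (w, x)) (by fun_prop)
  exact (hsurj.denseRange.comp hcd hΦx).mono Submodule.subset_span

end OrthonormalSections

/-! ### The bundle structure transported from a product by fiberwise isometries -/

namespace IsometricBundle

variable {M : Type*} [TopologicalSpace M]
  {F' : Type*} [NormedAddCommGroup F'] [InnerProductSpace ℝ F']
  {V : M → Type*} [∀ x, NormedAddCommGroup (V x)] [∀ x, InnerProductSpace ℝ (V x)]
  (L : ∀ x, F' ≃ₗᵢ[ℝ] V x)

/-- The bijection of the total space of a family of inner product spaces with a product, given by
isometries of its members with a fixed space. -/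
def equivProd : TotalSpace F' V ≃ M × F' where
  toFun p := (p.1, (L p.1).symm p.2)
  invFun q := ⟨q.1, L q.1 q.2⟩
  left_inv p := by simp
  right_inv q := by simp

/-- The topology on the total space for which `equivProd` is a homeomorphism. -/
abbrev topology : TopologicalSpace (TotalSpace F' V) :=
  .induced (equivProd L) inferInstance

/-- The global trivialization given by `equivProd`. -/
def trivialization : letI := topology L; Trivialization F' (π F' V) :=
  letI := topology L
  { toOpenPartialHomeomorph := ((equivProd L).toHomeomorphOfIsInducing
      ⟨rfl⟩).toOpenPartialHomeomorph
    baseSet := Set.univ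
    open_baseSet := isOpen_univ
    source_eq := rfl
    target_eq := Set.univ_prod_univ.symm
    proj_toFun := fun _ _ => rfl }

/-- The fiber bundle with the single trivialization `trivialization L`. -/
abbrev fiberBundle : letI := topology L; FiberBundle F' V :=
  letI := topology L
  { totalSpaceMk_isInducing' := fun x => by
      refine (Topology.IsInducing.of_comp_iff (g := equivProd L) ⟨rfl⟩).1 ?_
      exact (Topology.isInducing_const_prod (x := x)).2
        (L x).symm.toHomeomorph.isInducing
    trivializationAtlas' := {trivialization L}
    trivializationAt' := fun _ => trivialization L
    mem_baseSet_trivializationAt' := Set.mem_univ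
    trivialization_mem_atlas' := fun _ => Set.mem_singleton _ }

theorem eq_trivialization (t : letI := topology L; Trivialization F' (π F' V))
    (ht : letI := topology L; letI := fiberBundle L; MemTrivializationAtlas t) :
    t = trivialization L := ht.out

theorem isLinear : letI := topology L; (trivialization L).IsLinear ℝ :=
  let := topology L
  ⟨fun x _ => ⟨fun v w => (L x).symm.map_add v w, fun c v => (L x).symm.map_smul c v⟩⟩

theorem coordChangeL_eq (x : M) :
    letI := topology L; letI := isLinear L
    ((trivialization L).coordChangeL ℝ (trivialization L) x : F' →L[ℝ] F') = .id ℝ F' := by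
  let := topology L
  let := isLinear L
  ext v
  have := (trivialization L).coordChangeL_apply (R := ℝ) (trivialization L)
    (b := x) ⟨Set.mem_univ _, Set.mem_univ _⟩ v
  refine this.trans ?_
  rw [(trivialization L).apply_mk_symm (Set.mem_univ x)]
  rfl

theorem vectorBundle : letI := topology L; letI := fiberBundle L; VectorBundle ℝ F' V :=
  let := topology L
  let := fiberBundle L
  { trivialization_linear' := fun t ht => by
      obtain rfl := eq_trivialization L t ht
      exact isLinear L
    continuousOn_coordChange' := fun t t' ht ht' => by
      obtain rfl := eq_trivialization L t ht
      obtain rfl := eq_trivialization L t' ht'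
      refine (continuousOn_const (c := ContinuousLinearMap.id ℝ F')).congr fun x _ => ?_
      exact coordChangeL_eq L x }

variable {EM : Type*} [NormedAddCommGroup EM] [NormedSpace ℝ EM]
  {HM : Type*} [TopologicalSpace HM] (I : ModelWithCorners ℝ EM HM) [ChartedSpace HM M]

theorem contMDiffVectorBundle (n : WithTop ℕ∞) :
    letI := topology L; letI := fiberBundle L; letI := vectorBundle L
    ContMDiffVectorBundle n F' V I :=
  let := topology L
  let := fiberBundle L
  let := vectorBundle L
  { contMDiffOn_coordChangeL := fun t t' ht ht' => by
      obtain rfl := eq_trivialization L t ht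
      obtain rfl := eq_trivialization L t' ht'
      refine (contMDiffOn_const (c := ContinuousLinearMap.id ℝ F')).congr fun x _ => ?_
      exact coordChangeL_eq L x }

theorem symm_apply (x : M) (v : F') :
    letI := topology L; (trivialization L).symm x v = L x v := by
  let := topology L
  have h := (trivialization L).mk_symm (Set.mem_univ x) v
  exact eq_of_heq (TotalSpace.mk.inj h).2

/-- Since the maps `L x` are isometries, the metric is constant in the only trivialization. -/
theorem isContMDiffRiemannianBundle (n : WithTop ℕ∞) :
    letI := topology L; letI := fiberBundle L; letI := vectorBundle L
    IsContMDiffRiemannianBundle I n F' V := by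
  let := topology L
  let := fiberBundle L
  let := vectorBundle L
  refine ⟨fun x => innerSL ℝ, fun x => ?_, fun x v w => rfl⟩
  rw [contMDiffAt_section]
  let c : F' →L[ℝ] F' →L[ℝ] ℝ := innerSL ℝ
  refine (contMDiffAt_const (c := c)).congr_of_eventuallyEq (.of_forall fun y => ?_)
  ext v w
  change ContinuousLinearMap.inCoordinates F' V (F' →L[ℝ] ℝ) (fun x => V x →L[ℝ] ℝ) x y x y
    (innerSL ℝ) v w = c v w
  rw [inCoordinates_apply_eq₂
    (Set.mem_univ _) (Set.mem_univ _) (Set.mem_univ _)]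
  have h : ∀ v, (trivializationAt F' V x).symm y v = L y v := symm_apply L y
  rw [h, h]
  exact (LinearMap.congr_fun (Trivial.linearMapAt_trivialization ℝ M ℝ y) _).trans
    ((L y).inner_map_map v w)

variable {EN : Type*} [NormedAddCommGroup EN] [NormedSpace ℝ EN]
  {HN : Type*} [TopologicalSpace HN] {J : ModelWithCorners ℝ EN HN}
  {N : Type*} [TopologicalSpace N] [ChartedSpace HN N]

/-- Reduces smoothness of the inclusion and of the projection of a subbundle to smoothness of frame
coordinates. -/
theorem contMDiff_iff {n : WithTop ℕ∞} {f : N → TotalSpace F' V} :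
    letI := topology L; letI := fiberBundle L
    (ContMDiff J (I.prod 𝓘(ℝ, F')) n f ↔
      ContMDiff J I n (fun y => (f y).1) ∧
        ContMDiff J 𝓘(ℝ, F') n fun y => (L (f y).1).symm (f y).2) := by
  let := topology L
  let := fiberBundle L
  let := vectorBundle L
  let := contMDiffVectorBundle L I n
  have : MemTrivializationAtlas (trivialization L) := ⟨rfl⟩
  exact (trivialization L).contMDiff_iff fun _ => Set.mem_univ _

end IsometricBundle

/-! ### Subbundles spanned by finite orthonormal frames -/

section OrthonormalSpan

variable {ι : Type*} [Fintype ι] {V : Type*} [NormedAddCommGroup V] [InnerProductSpace ℝ V]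

/-- A finite orthonormal family, as a basis of its span. -/
def Orthonormal.spanBasis {v : ι → V} (hv : Orthonormal ℝ v) :
    OrthonormalBasis ι ℝ (Submodule.span ℝ (Set.range v)) :=
  OrthonormalBasis.mk (v := fun i => ⟨v i, Submodule.subset_span ⟨i, rfl⟩⟩)
    (by
      classical
      rw [orthonormal_iff_ite] at hv ⊢
      exact hv)
    (by
      rw [top_le_iff, ← Submodule.map_injective_of_injective
        (Submodule.subtype_injective _) |>.eq_iff, Submodule.map_span, ← Set.range_comp]
      simp [Function.comp_def])

theorem Orthonormal.coe_spanBasis {v : ι → V} (hv : Orthonormal ℝ v) (i : ι) :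
    (hv.spanBasis i : V) = v i := by
  simp [Orthonormal.spanBasis]

theorem OrthonormalBasis.coe_orthogonalProjectionOnto {K : Submodule ℝ V}
    [K.HasOrthogonalProjection] (b : OrthonormalBasis ι ℝ K) (w : V) :
    (K.orthogonalProjectionOnto w : V) = ∑ i, inner ℝ (b i : V) w • (b i : V) := by
  rw [← b.sum_repr (K.orthogonalProjectionOnto w)]
  simp [OrthonormalBasis.repr_apply_apply]

end OrthonormalSpan

section Frame

variable {M : Type*} {E : M → Type*}
  [∀ x, NormedAddCommGroup (E x)] [∀ x, InnerProductSpace ℝ (E x)]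
  {ι : Type*} [Fintype ι] {F' : Type*} [NormedAddCommGroup F'] [InnerProductSpace ℝ F']
  (b : OrthonormalBasis ι ℝ F') {s : ι → ∀ x, E x}

/-- The isometry of the span of an orthonormal frame at a point with the model space. -/
def frameIsometry (ho : ∀ x, Orthonormal ℝ fun i => s i x) (x : M) :
    F' ≃ₗᵢ[ℝ] Submodule.span ℝ (Set.range fun i => s i x) :=
  b.repr.trans (ho x).spanBasis.repr.symm

theorem frameIsometry_symm_apply (ho : ∀ x, Orthonormal ℝ fun i => s i x) (x : M)
    (w : Submodule.span ℝ (Set.range fun i => s i x)) :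
    (frameIsometry b ho x).symm w = ∑ i, inner ℝ (s i x) (w : E x) • b i := by
  rw [frameIsometry, LinearIsometryEquiv.symm_trans, LinearIsometryEquiv.trans_apply,
    ← b.sum_repr_symm]
  simp [OrthonormalBasis.repr_apply_apply, Submodule.coe_inner, Orthonormal.coe_spanBasis]

theorem coe_frameIsometry_apply (ho : ∀ x, Orthonormal ℝ fun i => s i x) (x : M) (v : F') :
    (frameIsometry b ho x v : E x) = ∑ i, inner ℝ (b i) v • s i x := by
  rw [frameIsometry, LinearIsometryEquiv.trans_apply, ← OrthonormalBasis.sum_repr_symm]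
  simp [OrthonormalBasis.repr_apply_apply, Orthonormal.coe_spanBasis]

end Frame

section Subbundle

variable {EM : Type*} [NormedAddCommGroup EM] [NormedSpace ℝ EM]
  {HM : Type*} [TopologicalSpace HM] {I : ModelWithCorners ℝ EM HM}
  {M : Type*} [TopologicalSpace M] [ChartedSpace HM M]
  {F : Type*} [NormedAddCommGroup F] [NormedSpace ℝ F]
  {E : M → Type*} [TopologicalSpace (TotalSpace F E)]
  [∀ x, NormedAddCommGroup (E x)] [∀ x, InnerProductSpace ℝ (E x)]
  [FiberBundle F E] [VectorBundle ℝ F E]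
  {ι : Type*} [Fintype ι] {F' : Type*} [NormedAddCommGroup F'] [InnerProductSpace ℝ F']
  (b : OrthonormalBasis ι ℝ F') {s : ι → ∀ x, E x}

variable (hs : ∀ i, ContMDiff I (I.prod 𝓘(ℝ, F)) ∞ (fun x => (⟨x, s i x⟩ : TotalSpace F E)))
  (ho : ∀ x, Orthonormal ℝ fun i => s i x)

/-- The subbundle spanned by finitely many smooth orthonormal sections. -/
def SmoothSubbundle.ofOrthonormalFrame : SmoothSubbundle I F E F' :=
  letI := IsometricBundle.topology (frameIsometry b ho)
  letI := IsometricBundle.fiberBundle (frameIsometry b ho)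
  { fiber := fun x => Submodule.span ℝ (Set.range fun i => s i x)
    topologicalSpaceTotal := IsometricBundle.topology (frameIsometry b ho)
    fiberBundle := IsometricBundle.fiberBundle (frameIsometry b ho)
    vectorBundle := IsometricBundle.vectorBundle (frameIsometry b ho)
    contMDiffVectorBundle := IsometricBundle.contMDiffVectorBundle (frameIsometry b ho) I ∞
    isContMDiffRiemannianBundle :=
      IsometricBundle.isContMDiffRiemannianBundle (frameIsometry b ho) I ∞
    contMDiff_inclusion := by
      -- Applied to the identity, the criterion says that base point and frame coordinates are
      -- smooth on the total space; the inclusion is a combination of the `s i` with these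
      -- coefficients.
      obtain ⟨h1, h2⟩ := (IsometricBundle.contMDiff_iff (frameIsometry b ho) I (n := ∞)
        (J := I.prod 𝓘(ℝ, F')) (f := id)).1 contMDiff_id
      intro p
      refine (ContMDiffAt.sum_bundle (I := I) (F := F) (E := E) Finset.univ
        (v := fun i p => inner ℝ (b i) ((frameIsometry b ho p.1).symm p.2) • s i p.1)
        (b := fun p => p.1) h1.contMDiffAt fun i _ => ?_).congr_of_eventuallyEq
        (.of_forall fun p => ?_)
      · refine ContMDiffAt.smul_bundle ?_ ((hs i).comp h1).contMDiffAt
        exact ((innerSL ℝ (b i)).contMDiff.comp h2).contMDiffAt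
      · simp only [← coe_frameIsometry_apply b ho, LinearIsometryEquiv.apply_symm_apply] }

/-- The frame coordinates of the projection of `v` are `⟨s i, v⟩`, smooth because the metric is. -/
theorem SmoothSubbundle.contMDiff_projection_ofOrthonormalFrame [FiniteDimensional ℝ F']
    [IsContMDiffRiemannianBundle I ∞ F E] :
    ContMDiff (I.prod 𝓘(ℝ, F)) (I.prod 𝓘(ℝ, F')) ∞
      (SmoothSubbundle.ofOrthonormalFrame b hs ho).projection := by
  refine (IsometricBundle.contMDiff_iff (frameIsometry b ho) I).2 ⟨contMDiff_proj E, ?_⟩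
  have h : ∀ i, ContMDiff (I.prod 𝓘(ℝ, F)) 𝓘(ℝ, ℝ) ∞
      (fun p : TotalSpace F E => inner ℝ (s i p.1) p.2) := fun i =>
    ContMDiff.inner_bundle (F := F) (E := E) ((hs i).comp (contMDiff_proj E)) contMDiff_id
  refine (ContMDiff.sum (t := Finset.univ) fun i _ =>
    (h i).smul (contMDiff_const (c := b i))).congr fun p => ?_
  refine (frameIsometry_symm_apply b ho _ _).trans (Finset.sum_congr rfl fun i _ => ?_)
  congr 1
  have hi : s i p.1 ∈ (SmoothSubbundle.ofOrthonormalFrame b hs ho).fiber p.1 :=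
    Submodule.subset_span ⟨i, rfl⟩
  exact Submodule.inner_orthogonalProjectionOnto_eq_of_mem_left ⟨_, hi⟩ p.2

end Subbundle

/-! ### Modifying trivializations by families of operators -/

section LocalModel

variable {EM : Type*} [NormedAddCommGroup EM] [NormedSpace ℝ EM]
  {HM : Type*} [TopologicalSpace HM] {I : ModelWithCorners ℝ EM HM}
  {M : Type*} [TopologicalSpace M] [ChartedSpace HM M]
  {F : Type*} [NormedAddCommGroup F] [NormedSpace ℝ F]

/-- A trivialization can be modified near a point by a smooth family of operators on the fiber
which is invertible at that point. -/
theorem Bundle.Trivialization.exists_clm_comp {n : WithTop ℕ∞} [CompleteSpace F] {E : M → Type*}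
    [TopologicalSpace (TotalSpace F E)]
    [∀ x, TopologicalSpace (E x)] [∀ x, AddCommGroup (E x)] [∀ x, Module ℝ (E x)]
    [FiberBundle F E] [VectorBundle ℝ F E] [ContMDiffVectorBundle n F E I]
    (ψ : Trivialization F (π F E)) [MemTrivializationAtlas ψ] {p : M} (hp : p ∈ ψ.baseSet)
    {A : M → F →L[ℝ] F} (hA : ContMDiffOn I 𝓘(ℝ, F →L[ℝ] F) n A ψ.baseSet)
    (hinv : (A p).IsInvertible) :
    ∃ φ : Trivialization F (π F E), p ∈ φ.baseSet ∧ φ.baseSet ⊆ ψ.baseSet ∧ φ.IsLinear ℝ ∧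
      ContMDiffOn (I.prod 𝓘(ℝ, F)) (I.prod 𝓘(ℝ, F)) n φ φ.source ∧
      ContMDiffOn (I.prod 𝓘(ℝ, F)) (I.prod 𝓘(ℝ, F)) n φ.toOpenPartialHomeomorph.symm φ.target ∧
      ∀ x ∈ φ.baseSet, ∀ v : E x, (φ ⟨x, v⟩).2 = A x (ψ ⟨x, v⟩).2 := by
  classical
  -- Open because invertible operators on a complete space form an open set; inversion is smooth
  -- there, which gives the smooth inverse.
  let U : Set M := ψ.baseSet ∩ A ⁻¹' Set.range ((↑) : (F ≃L[ℝ] F) → F →L[ℝ] F)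
  have hU : IsOpen U :=
    hA.continuousOn.isOpen_inter_preimage ψ.open_baseSet ContinuousLinearEquiv.isOpen
  let T : M → F ≃L[ℝ] F := fun x =>
    if h : (A x).IsInvertible then h.choose else .refl ℝ F
  have hT : ∀ x ∈ U, (T x : F →L[ℝ] F) = A x := fun x hx => by
    have h : (A x).IsInvertible := hx.2
    simp only [T, dif_pos h]
    exact h.choose_spec
  have hsm : ContMDiffOn I 𝓘(ℝ, F →L[ℝ] F) n (fun x => (T x : F →L[ℝ] F)) U :=
    (hA.mono Set.inter_subset_left).congr hT
  have hsm' : ContMDiffOn I 𝓘(ℝ, F →L[ℝ] F) n (fun x => ((T x).symm : F →L[ℝ] F)) U := by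
    intro x hx
    have h1 : ContMDiffAt 𝓘(ℝ, F →L[ℝ] F) 𝓘(ℝ, F →L[ℝ] F) n ContinuousLinearMap.inverse
        (T x : F →L[ℝ] F) := (contDiffAt_map_inverse (T x)).contMDiffAt
    refine (h1.comp_contMDiffWithinAt x (hsm x hx)).congr (fun y _ => ?_) ?_ <;>
    simp
  let L := FiberwiseLinear.openPartialHomeomorph T hU hsm.continuousOn hsm'.continuousOn
  have hLs : L.source = U ×ˢ Set.univ := rfl
  have hLt : L.target = U ×ˢ Set.univ := rfl
  have hL : ContMDiffOn (I.prod 𝓘(ℝ, F)) (I.prod 𝓘(ℝ, F)) n L L.source :=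
    contMDiffOn_fst.prodMk ((hsm.comp contMDiffOn_fst
      (Set.prod_subset_preimage_fst _ _)).clm_apply contMDiffOn_snd)
  have hL' : ContMDiffOn (I.prod 𝓘(ℝ, F)) (I.prod 𝓘(ℝ, F)) n L.symm L.target :=
    contMDiffOn_fst.prodMk ((hsm'.comp contMDiffOn_fst
      (Set.prod_subset_preimage_fst _ _)).clm_apply contMDiffOn_snd)
  let φ : Trivialization F (π F E) :=
    { toOpenPartialHomeomorph := ψ.toOpenPartialHomeomorph.trans L
      baseSet := U
      open_baseSet := hU
      source_eq := by
        ext q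
        rw [OpenPartialHomeomorph.trans_source, hLs]
        constructor
        · rintro ⟨h1, h2, -⟩
          rwa [ψ.coe_coe, ψ.coe_fst h1] at h2
        · intro h
          have h1 : q ∈ ψ.source := ψ.mem_source.2 h.1
          refine ⟨h1, ?_, trivial⟩
          rwa [ψ.coe_coe, ψ.coe_fst h1]
      target_eq := by
        ext q
        rw [OpenPartialHomeomorph.trans_target, hLt]
        constructor
        · exact fun h => h.1
        · exact fun h => ⟨h, ψ.mem_target.2 h.1.1⟩
      proj_toFun := fun q hq => by
        rw [OpenPartialHomeomorph.trans_source] at hq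
        exact ψ.coe_fst hq.1 }
  have hφ : ∀ x ∈ U, ∀ v : E x, (φ ⟨x, v⟩).2 = A x (ψ ⟨x, v⟩).2 := fun x hx v => by
    have h1 : (ψ ⟨x, v⟩).1 = x := ψ.coe_fst' hx.1
    have : (φ ⟨x, v⟩).2 = T (ψ ⟨x, v⟩).1 (ψ ⟨x, v⟩).2 := rfl
    rw [this, h1, ← hT x hx]
    rfl
  refine ⟨φ, ⟨hp, hinv⟩, Set.inter_subset_left, ⟨fun x hx => ?_⟩, ?_, ?_, hφ⟩
  · have hl := ψ.linear ℝ hx.1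
    exact ⟨fun v w => by simp only [hφ x hx, hl.map_add, map_add],
      fun c v => by simp only [hφ x hx, hl.map_smul, map_smul]⟩
  · exact hL.comp (ψ.contMDiffOn.mono fun q hq => hq.1) fun q hq => hq.2
  · exact ψ.contMDiffOn_symm.comp (hL'.mono fun q hq => hq.1) fun q hq => hq.2

variable {E : M → Type*} [TopologicalSpace (TotalSpace F E)]
  [∀ x, NormedAddCommGroup (E x)] [∀ x, InnerProductSpace ℝ (E x)]
  [FiberBundle F E] [VectorBundle ℝ F E]

/-- The functional `⟨σ, ·⟩` given by a smooth section, in a trivialization. -/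
theorem ContMDiff.innerSL_comp_symmL {n : WithTop ℕ∞} [ContMDiffVectorBundle n F E I]
    [IsContMDiffRiemannianBundle I n F E] {σ : ∀ x, E x}
    (hσ : ContMDiff I (I.prod 𝓘(ℝ, F)) n (fun x => (⟨x, σ x⟩ : TotalSpace F E))) (p : M) :
    ContMDiffOn I 𝓘(ℝ, F →L[ℝ] ℝ) n
      (fun x => (innerSL ℝ (σ x)) ∘L (trivializationAt F E p).symmL ℝ x)
      (trivializationAt F E p).baseSet := by
  obtain ⟨g, hg, hgi⟩ := ‹IsContMDiffRiemannianBundle I n F E›.exists_contMDiff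
  -- Viewing `⟨σ, ·⟩` as a section of the dual bundle gives smoothness in operator norm, not merely
  -- pointwise.
  have h1 : ContMDiff I (I.prod 𝓘(ℝ, F →L[ℝ] ℝ)) n
      (fun x => (⟨x, g x (σ x)⟩ : TotalSpace (F →L[ℝ] ℝ) fun x => E x →L[ℝ] ℝ)) :=
    ContMDiff.clm_bundle_apply (E₂ := fun x => E x →L[ℝ] ℝ) hg hσ
  have h2 := ((trivializationAt (F →L[ℝ] ℝ) (fun x => E x →L[ℝ] ℝ) p).contMDiffOn_section_iff
    (IB := I) (n := n) (s := fun x => g x (σ x)) (a := (trivializationAt F E p).baseSet)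
    (trivializationAt F E p).open_baseSet (fun x hx => ⟨hx, Set.mem_univ x⟩)).1 h1.contMDiffOn
  refine h2.congr fun x hx => ?_
  ext v
  change _ = (trivializationAt ℝ (fun _ : M => ℝ) p).continuousLinearMapAt ℝ x
    (g x (σ x) ((trivializationAt F E p).symmL ℝ x v))
  rw [← hgi]
  exact (LinearMap.congr_fun (Trivial.linearMapAt_trivialization ℝ M ℝ x) _).symm

end LocalModel

/-! ### Local trivializations straightening the projection -/

section Modelled

variable {EM : Type*} [NormedAddCommGroup EM] [NormedSpace ℝ EM]
  {HM : Type*} [TopologicalSpace HM] {I : ModelWithCorners ℝ EM HM}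
  {M : Type*} [TopologicalSpace M] [ChartedSpace HM M]
  {H : Type*} [NormedAddCommGroup H] [InnerProductSpace ℝ H]
  {E : M → Type*} [TopologicalSpace (TotalSpace H E)]
  [∀ x, NormedAddCommGroup (E x)] [∀ x, InnerProductSpace ℝ (E x)]
  [FiberBundle H E] [VectorBundle ℝ H E]

/-- Matches two Hilbert bases; the fiber is complete because it is linearly homeomorphic to `H`. -/
theorem exists_isometry_of_orthonormal_sections [CompleteSpace H] {s : ℕ → ∀ x, E x} {p : M}
    (ho : Orthonormal ℝ fun k => s k p)
    (hd : (Submodule.span ℝ (Set.range fun k => s k p)).topologicalClosure = ⊤)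
    {u : ℕ → H} (hu : Orthonormal ℝ u)
    (hud : (Submodule.span ℝ (Set.range u)).topologicalClosure = ⊤) :
    ∃ R : E p ≃ₗᵢ[ℝ] H, ∀ k, R (s k p) = u k := by
  have : CompleteSpace (E p) :=
    (((trivializationAt H E p).continuousLinearEquivAt ℝ p
      (FiberBundle.mem_baseSet_trivializationAt' p)).isUniformEmbedding.completeSpace_congr
        (ContinuousLinearEquiv.surjective _)).2 ‹_›
  refine ⟨(HilbertBasis.mk ho hd.ge).repr.trans (HilbertBasis.mk hu hud.ge).repr.symm,
    fun k => ?_⟩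
  have h := (HilbertBasis.mk ho hd.ge).repr_self k
  rw [HilbertBasis.coe_mk] at h
  rw [LinearIsometryEquiv.trans_apply, h, HilbertBasis.repr_symm_single, HilbertBasis.coe_mk]

variable {ι : Type*} [Fintype ι] {K : Submodule ℝ H} [FiniteDimensional ℝ K]
  (b : OrthonormalBasis ι ℝ K) {s : ι → ∀ x, E x}
  (hs : ∀ i, ContMDiff I (I.prod 𝓘(ℝ, H)) ∞ (fun x => (⟨x, s i x⟩ : TotalSpace H E)))
  (ho : ∀ x, Orthonormal ℝ fun i => s i x)

/-- Let `P x` be the projection onto the span of the frame. In `ψ`, the operator `A x` sends `s i x`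
to `b i` and treats the remainder `v - P x v` by the fixed map `T`, that is, `R` read in `ψ` at `p`,
followed by the projection `Q` off `K`. So it intertwines `P x` with the projection onto `K` for
every `x` in the base set of `ψ`. At `p` it is `R` itself, so it is invertible near `p`. -/
theorem SmoothSubbundle.isLocallyModelledOn_ofOrthonormalFrame [CompleteSpace H]
    [ContMDiffVectorBundle ∞ H E I] [IsContMDiffRiemannianBundle I ∞ H E]
    (hR : ∀ p, ∃ R : E p ≃ₗᵢ[ℝ] H, ∀ i, R (s i p) = b i) :
    (SmoothSubbundle.ofOrthonormalFrame b hs ho).IsLocallyModelledOn := by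
  intro p
  obtain ⟨R, hR⟩ := hR p
  let ψ := trivializationAt H E p
  have hp : p ∈ ψ.baseSet := FiberBundle.mem_baseSet_trivializationAt' p
  let α : ι → M → H →L[ℝ] ℝ := fun i x => (innerSL ℝ (s i x)) ∘L ψ.symmL ℝ x
  let T : H →L[ℝ] H := (R.toContinuousLinearEquiv : E p →L[ℝ] H) ∘L ψ.symmL ℝ p
  let Q : H →L[ℝ] H := .id ℝ H - K.starProjection
  let A : M → H →L[ℝ] H := fun x => ∑ i, (α i x).smulRight (b i : H) +
    Q ∘L T ∘L (.id ℝ H - ∑ i, (α i x).smulRight (ψ ⟨x, s i x⟩).2)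
  have hα : ∀ i, ContMDiffOn I 𝓘(ℝ, H →L[ℝ] ℝ) ∞ (α i) ψ.baseSet := fun i =>
    (hs i).innerSL_comp_symmL p
  have hσ : ∀ i, ContMDiffOn I 𝓘(ℝ, H) ∞ (fun x => (ψ ⟨x, s i x⟩).2) ψ.baseSet := fun i =>
    (ψ.contMDiffOn_section_iff ψ.open_baseSet subset_rfl).1 (hs i).contMDiffOn
  have hsmul : ∀ i (w : M → H), ContMDiffOn I 𝓘(ℝ, H) ∞ w ψ.baseSet →
      ContMDiffOn I 𝓘(ℝ, H →L[ℝ] H) ∞ (fun x => (α i x).smulRight (w x)) ψ.baseSet :=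
    fun i w hw => (contDiff_fst.smulRight contDiff_snd : ContDiff ℝ ∞
      fun q : (H →L[ℝ] ℝ) × H => q.1.smulRight q.2).contMDiff.comp_contMDiffOn
        ((hα i).prodMk_space hw)
  have hA : ContMDiffOn I 𝓘(ℝ, H →L[ℝ] H) ∞ A ψ.baseSet := by
    refine ContMDiffOn.add (contMDiffOn_finsetSum fun i _ => hsmul i _ contMDiffOn_const) ?_
    refine contMDiffOn_const.clm_comp (contMDiffOn_const.clm_comp ?_)
    exact contMDiffOn_const.sub (contMDiffOn_finsetSum fun i _ => hsmul i _ (hσ i))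
  have hα' : ∀ i, ∀ x ∈ ψ.baseSet, ∀ v : E x, α i x (ψ ⟨x, v⟩).2 = inner ℝ (s i x) v :=
    fun i x hx v => by
      have : ψ.symmL ℝ x (ψ ⟨x, v⟩).2 = v := by
        rw [ψ.symmL_apply hx]
        exact ψ.symm_apply_apply_mk hx v
      simp only [α, ContinuousLinearMap.comp_apply, this, innerSL_apply_apply]
  have hproj : ∀ x (v : E x), (((SmoothSubbundle.ofOrthonormalFrame b hs ho).fiber
      x).orthogonalProjectionOnto v : E x) = ∑ i, inner ℝ (s i x) v • s i x := fun x v => by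
    have : FiniteDimensional ℝ (Submodule.span ℝ (Set.range fun i => s i x)) :=
      FiniteDimensional.span_of_finite ℝ (Set.finite_range _)
    refine ((ho x).spanBasis.coe_orthogonalProjectionOnto v).trans ?_
    simp only [Orthonormal.coe_spanBasis]
  have hAψ : ∀ x ∈ ψ.baseSet, ∀ v : E x, A x (ψ ⟨x, v⟩).2 =
      ∑ i, inner ℝ (s i x) v • (b i : H) +
        Q (T (ψ ⟨x, v - ∑ i, inner ℝ (s i x) v • s i x⟩).2) := fun x hx v => by
    have h : (ψ ⟨x, v - ∑ i, inner ℝ (s i x) v • s i x⟩).2 =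
        (ψ ⟨x, v⟩).2 - ∑ i, inner ℝ (s i x) v • (ψ ⟨x, s i x⟩).2 := by
      have := map_sub (ψ.linearEquivAt ℝ x hx) v (∑ i, inner ℝ (s i x) v • s i x)
      simpa only [map_sum, map_smul, Trivialization.linearEquivAt_apply] using this
    simp only [A, h, add_apply, sum_apply,
      ContinuousLinearMap.comp_apply, sub_apply,
      ContinuousLinearMap.smulRight_apply, hα' _ x hx, ContinuousLinearMap.id_apply]
  have hinv : (A p).IsInvertible := by
    refine ⟨(ψ.continuousLinearEquivAt ℝ p hp).symm.trans R.toContinuousLinearEquiv, ?_⟩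
    ext w
    obtain ⟨v, rfl⟩ := (ψ.continuousLinearEquivAt ℝ p hp).surjective w
    have hT : ∀ v, T (ψ ⟨p, v⟩).2 = R v := fun v => by
      have : ψ.symmL ℝ p (ψ ⟨p, v⟩).2 = v := by
        rw [ψ.symmL_apply hp]
        exact ψ.symm_apply_apply_mk hp v
      simp only [T, ContinuousLinearMap.comp_apply, this]
      rfl
    -- `R` carries `s i p` to `b i`, hence `P p` to the projection onto `K`; the two summands of `A
    -- p` then add up to `R v`.
    have hP : ∀ v, ∑ i, inner ℝ (s i p) v • (b i : H) = K.starProjection (R v) := fun v => by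
      rw [Submodule.starProjection_apply, b.coe_orthogonalProjectionOnto]
      simp only [← hR, R.inner_map_map]
    have hK : K.starProjection (K.starProjection (R v)) = K.starProjection (R v) :=
      Submodule.starProjection_eq_self_iff.2 (K.starProjection_apply_mem _)
    refine Eq.trans ?_ (hAψ p hp v).symm
    rw [hT, map_sub, map_sum]
    simp only [map_smul, hR]
    rw [map_sub, hP]
    simp [Q, hK, ψ.symm_apply_apply_mk hp v]
  obtain ⟨φ, hpφ, hφψ, hlin, h1, h2, hφ⟩ := ψ.exists_clm_comp hp hA hinv
  refine ⟨φ, hpφ, hlin, h1, h2, fun x hx v => ?_⟩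
  rw [hφ x hx, hφ x hx, hAψ x (hφψ hx), hAψ x (hφψ hx), hproj]
  have hK : ∑ i, inner ℝ (s i x) v • (b i : H) ∈ K :=
    Submodule.sum_mem _ fun i _ => Submodule.smul_mem _ _ (b i).2
  have hQ : ∀ w, K.orthogonalProjectionOnto (Q w) = 0 := fun w => by
    change K.orthogonalProjectionOnto (w - (K.orthogonalProjectionOnto w : H)) = 0
    rw [map_sub, Submodule.orthogonalProjectionOnto_mem_subspace_eq_self, sub_self]
  have hidem : ∀ i, inner ℝ (s i x) (∑ j, inner ℝ (s j x) v • s j x) = inner ℝ (s i x) v :=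
    fun i => (ho x).inner_right_fintype _ i
  have h0 : (ψ ⟨x, (0 : E x)⟩).2 = 0 := (ψ.linear ℝ (hφψ hx)).map_zero
  simp only [hidem, sub_self, h0, map_zero, add_zero, map_add, hQ]
  exact (congrArg Subtype.val (K.orthogonalProjectionOnto_mem_subspace_eq_self ⟨_, hK⟩)).symm

end Modelled

/-! ### Compressing connections to a subbundle -/

section Compression

variable {EM : Type*} [NormedAddCommGroup EM] [NormedSpace ℝ EM]
  {HM : Type*} [TopologicalSpace HM] {I : ModelWithCorners ℝ EM HM}
  {M : Type*} [TopologicalSpace M] [ChartedSpace HM M]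
  {F : Type*} [NormedAddCommGroup F] [NormedSpace ℝ F]
  {E : M → Type*} [TopologicalSpace (TotalSpace F E)]
  [∀ x, NormedAddCommGroup (E x)] [∀ x, InnerProductSpace ℝ (E x)]
  [FiberBundle F E]

namespace SmoothSubbundle

section

variable {F' : Type*} [NormedAddCommGroup F'] [NormedSpace ℝ F']
  (S : SmoothSubbundle I F E F')

theorem mdifferentiableAt_coe {τ : ∀ x, S.fiber x} {x : M}
    (hτ : MDifferentiableAt I (I.prod 𝓘(ℝ, F'))
      (fun y => (⟨y, τ y⟩ : TotalSpace F' fun x => S.fiber x)) x) :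
    MDifferentiableAt I (I.prod 𝓘(ℝ, F)) (fun y => (⟨y, (τ y : E y)⟩ : TotalSpace F E)) x :=
  (S.contMDiff_inclusion.mdifferentiable (by simp) _).comp x hτ

theorem contMDiff_coe {n : WithTop ℕ∞} (hn : n ≤ ∞) {τ : ∀ x, S.fiber x}
    (hτ : ContMDiff I (I.prod 𝓘(ℝ, F')) n
      (fun y => (⟨y, τ y⟩ : TotalSpace F' fun x => S.fiber x))) :
    ContMDiff I (I.prod 𝓘(ℝ, F)) n (fun y => (⟨y, (τ y : E y)⟩ : TotalSpace F E)) :=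
  (S.contMDiff_inclusion.of_le hn).comp hτ

variable [FiniteDimensional ℝ F']

/-- The compression of a connection to a subbundle is a connection. -/
def compressCovariantDerivative (cov : CovariantDerivative I F E) :
    CovariantDerivative I F' (fun x => S.fiber x) where
  toFun := S.compress cov
  isCovariantDerivativeOnUniv :=
    { add := fun {σ σ' x} hσ hσ' _ => by
        have h := cov.isCovariantDerivativeOnUniv.add (S.mdifferentiableAt_coe hσ)
          (S.mdifferentiableAt_coe hσ')
        have h' : (fun y => ((σ + σ') y : E y)) =
          (fun y => (σ y : E y)) + fun y => (σ' y : E y) := rfl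
        simp only [compress, h', h, ContinuousLinearMap.comp_add]
      leibniz := fun {σ g x} hσ hg _ => by
        have h := cov.isCovariantDerivativeOnUniv.leibniz (S.mdifferentiableAt_coe hσ) hg
        have h' : (fun y => ((g • σ) y : E y)) = g • fun y => (σ y : E y) := rfl
        simp only [compress, h', h, ContinuousLinearMap.comp_add]
        ext v
        simp }

/-- The projection is self-adjoint and fixes sections of the subbundle, so it drops out of both
pairings. -/
theorem isCompatible_compressCovariantDerivative [IsManifold I 1 M]
    {cov : CovariantDerivative I F E} (hcov : cov.IsCompatible) :
    (S.compressCovariantDerivative cov).IsCompatible := by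
  intro X σ τ hX hσ hτ x
  refine (hcov X _ _ hX (S.contMDiff_coe le_rfl hσ) (S.contMDiff_coe le_rfl hτ) x).trans ?_
  congr 1
  · exact (Submodule.inner_orthogonalProjectionOnto_eq_of_mem_right (τ x) _).symm
  · exact (Submodule.inner_orthogonalProjectionOnto_eq_of_mem_left (σ x) _).symm

end

variable [VectorBundle ℝ F E]
  {ι : Type*} [Fintype ι] {F' : Type*} [NormedAddCommGroup F'] [InnerProductSpace ℝ F']
  [FiniteDimensional ℝ F'] (b : OrthonormalBasis ι ℝ F') {s : ι → ∀ x, E x}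
  (hs : ∀ i, ContMDiff I (I.prod 𝓘(ℝ, F)) ∞ (fun x => (⟨x, s i x⟩ : TotalSpace F E)))
  (ho : ∀ x, Orthonormal ℝ fun i => s i x)

/-- Needed because a connection applied to a section is a section of a Hom bundle. In coordinates
the projection is the finite-rank operator `∑ ⟨s i, ·⟩ b i`, which is smooth in operator norm. -/
theorem contMDiff_orthogonalProjectionOnto_comp [IsManifold I 1 M]
    [ContMDiffVectorBundle ∞ F E I] [IsContMDiffRiemannianBundle I ∞ F E]
    {c : ∀ x, TangentSpace I x →L[ℝ] E x}
    (hc : ContMDiff I (I.prod 𝓘(ℝ, EM →L[ℝ] F)) ∞ (fun x =>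
      (⟨x, c x⟩ : TotalSpace (EM →L[ℝ] F) fun x => TangentSpace I x →L[ℝ] E x))) :
    ContMDiff I (I.prod 𝓘(ℝ, EM →L[ℝ] F')) ∞ (fun x =>
      (⟨x, ((ofOrthonormalFrame b hs ho).fiber x).orthogonalProjectionOnto ∘L c x⟩ :
        TotalSpace (EM →L[ℝ] F')
          fun x => TangentSpace I x →L[ℝ] (ofOrthonormalFrame b hs ho).fiber x)) := by
  intro p
  let S := ofOrthonormalFrame b hs ho
  let ψ := trivializationAt F E p
  have hp : p ∈ ψ.baseSet := FiberBundle.mem_baseSet_trivializationAt' p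
  let α : ι → M → F →L[ℝ] ℝ := fun i x => (innerSL ℝ (s i x)) ∘L ψ.symmL ℝ x
  have hα : ∀ i, ContMDiffAt I 𝓘(ℝ, F →L[ℝ] ℝ) ∞ (α i) p := fun i =>
    ((hs i).innerSL_comp_symmL p).contMDiffAt (ψ.open_baseSet.mem_nhds hp)
  have hsmul : ∀ i, ContMDiffAt I 𝓘(ℝ, F →L[ℝ] F') ∞ (fun x => (α i x).smulRight (b i)) p :=
    fun i => (contDiff_id.smulRight contDiff_const : ContDiff ℝ ∞
      fun q : F →L[ℝ] ℝ => q.smulRight (b i)).contMDiff.contMDiffAt.comp p (hα i)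
  have hc' := (contMDiffAt_hom_bundle _).1 (hc p)
  refine (contMDiffAt_hom_bundle (IB := I) (IM := I) (F₁ := EM) (E₁ := TangentSpace I) (F₂ := F')
    (E₂ := fun x => S.fiber x) _).2 ⟨contMDiffAt_id, ?_⟩
  refine ((ContMDiffAt.sum (t := Finset.univ) fun i _ => hsmul i).clm_comp
    hc'.2).congr_of_eventuallyEq ?_
  filter_upwards [ψ.open_baseSet.mem_nhds hp] with x hx
  ext v
  let w := c x ((trivializationAt EM (TangentSpace I) p).symmL ℝ x v)
  have hw : ψ.symmL ℝ x (ψ.continuousLinearMapAt ℝ x w) = w :=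
    ψ.symmL_continuousLinearMapAt hx w
  -- The subbundle has a single trivialization, given by frame coordinates.
  have h₁ : ContinuousLinearMap.inCoordinates EM (TangentSpace I) F' (fun x => S.fiber x) p x p x
      ((S.fiber x).orthogonalProjectionOnto ∘L c x) v =
      (frameIsometry b ho x).symm ((S.fiber x).orthogonalProjectionOnto w) :=
    congrFun ((trivializationAt F' (fun x => S.fiber x) p).coe_linearMapAt_of_mem (R := ℝ)
      (Set.mem_univ x)) _
  refine h₁.trans ((frameIsometry_symm_apply b ho x _).trans ?_)
  simp only [ContinuousLinearMap.comp_apply, _root_.sum_apply,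
    ContinuousLinearMap.smulRight_apply]
  refine Finset.sum_congr rfl fun i _ => ?_
  congr 1
  have hi : s i x ∈ S.fiber x := Submodule.subset_span ⟨i, rfl⟩
  refine (Submodule.inner_orthogonalProjectionOnto_eq_of_mem_left ⟨_, hi⟩ w).trans ?_
  exact congrArg (inner ℝ (s i x)) hw.symm

theorem contMDiffCovariantDerivative_compressCovariantDerivative [IsManifold I 1 M]
    [ContMDiffVectorBundle ∞ F E I] [IsContMDiffRiemannianBundle I ∞ F E]
    {cov : CovariantDerivative I F E} (hcov : cov.ContMDiffCovariantDerivative ∞) :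
    ((ofOrthonormalFrame b hs ho).compressCovariantDerivative
      cov).ContMDiffCovariantDerivative ∞ where
  contMDiff := ⟨fun {σ} hσ => by
    have h := hcov.contMDiff.contMDiff
      ((ofOrthonormalFrame b hs ho).contMDiff_coe le_rfl (contMDiffOn_univ.1 hσ)).contMDiffOn
    exact (contMDiff_orthogonalProjectionOnto_comp b hs ho (contMDiffOn_univ.1 h)).contMDiffOn⟩

end SmoothSubbundle

end Compression

/-! ### Orthonormal bases of the model subspaces, and the theorem -/

section InitialSpan

variable {H : Type*} [NormedAddCommGroup H] [InnerProductSpace ℝ H] {e : ℕ → H}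

theorem IsOrthogonalBasis.span_range_normalized_val (he : IsOrthogonalBasis e) (d : ℕ) :
    Submodule.span ℝ (Set.range fun i : Fin d => IsOrthogonalBasis.normalized e i) =
      initialSpan e d := by
  rw [initialSpan, ← he.span_normalized_image]
  congr 1
  ext v
  simp only [Set.mem_range, Set.mem_image, Set.mem_Iio]
  exact ⟨fun ⟨i, h⟩ => ⟨i, i.2, h⟩, fun ⟨i, hi, h⟩ => ⟨⟨i, hi⟩, h⟩⟩

theorem IsOrthogonalBasis.exists_orthonormalBasis_initialSpan (he : IsOrthogonalBasis e) (d : ℕ) :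
    ∃ b : OrthonormalBasis (Fin d) ℝ (initialSpan e d),
      ∀ i, (b i : H) = IsOrthogonalBasis.normalized e i := by
  have ho : Orthonormal ℝ fun i : Fin d => IsOrthogonalBasis.normalized e i :=
    he.orthonormal_normalized.comp _ Fin.val_injective
  rw [← he.span_range_normalized_val]
  exact ⟨ho.spanBasis, ho.coe_spanBasis⟩

theorem IsOrthogonalBasis.dense_span_normalized (he : IsOrthogonalBasis e) :
    (Submodule.span ℝ (Set.range (IsOrthogonalBasis.normalized e))).topologicalClosure = ⊤ := by
  rw [← Set.image_univ, he.span_normalized_image, Set.image_univ, he.dense_span]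

end InitialSpan

end

theorem mainTheorem5 {m : ℕ}
    {M : Type*} [TopologicalSpace M] [ChartedSpace (EuclideanSpace ℝ (Fin m)) M]
    [IsManifold (𝓡 m) ∞ M] [CompactSpace M] [T2Space M]
    {H : Type*} [NormedAddCommGroup H] [InnerProductSpace ℝ H] [CompleteSpace H]
    {E : M → Type*} [TopologicalSpace (TotalSpace H E)]
    [∀ x, NormedAddCommGroup (E x)] [∀ x, InnerProductSpace ℝ (E x)]
    [FiberBundle H E] [VectorBundle ℝ H E]
    [ContMDiffVectorBundle ∞ H E (𝓡 m)] [IsContMDiffRiemannianBundle (𝓡 m) ∞ H E]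
    (e : ℕ → H) (he : IsOrthogonalBasis e) :
    ∃ S : ∀ d : ℕ, SmoothSubbundle (𝓡 m) H E (initialSpan e d),
      (∀ d x, (S d).fiber x ≤ (S (d + 1)).fiber x) ∧
      (∀ x, (⨆ d, (S d).fiber x).topologicalClosure = ⊤) ∧
      ∀ d,
        (∀ x, Module.finrank ℝ ((S d).fiber x) = d) ∧
        (S d).IsLocallyModelledOn ∧
        ContMDiff ((𝓡 m).prod 𝓘(ℝ, H)) ((𝓡 m).prod 𝓘(ℝ, initialSpan e d)) ∞ (S d).projection ∧
        ∀ cov : CovariantDerivative (𝓡 m) H E,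
          cov.ContMDiffCovariantDerivative ∞ → cov.IsCompatible →
          ∃ cov' : CovariantDerivative (𝓡 m) (initialSpan e d) (fun x => (S d).fiber x),
            (cov' : (∀ x, (S d).fiber x) → ∀ x, TangentSpace (𝓡 m) x →L[ℝ] (S d).fiber x) =
              (S d).compress cov ∧
            cov'.ContMDiffCovariantDerivative ∞ ∧ cov'.IsCompatible := by
  have := he.separableSpace
  obtain ⟨s, hs, ho, hd⟩ := exists_orthonormal_sections (I := 𝓡 m) (F := H) (E := E)
    he.not_finiteDimensional
  choose b hb using he.exists_orthonormalBasis_initialSpan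
  have hs' : ∀ d (i : Fin d), ContMDiff (𝓡 m) ((𝓡 m).prod 𝓘(ℝ, H)) ∞
      (fun x => (⟨x, s i x⟩ : TotalSpace H E)) := fun d i => hs i
  have ho' : ∀ (d : ℕ) x, Orthonormal ℝ fun i : Fin d => s i x := fun d x =>
    (ho x).comp _ Fin.val_injective
  refine ⟨fun d => SmoothSubbundle.ofOrthonormalFrame (b d) (hs' d) (ho' d), fun d x => ?_,
    fun x => ?_, fun d => ⟨fun x => ?_, ?_, ?_, fun cov hcov hcomp => ?_⟩⟩
  · refine Submodule.span_mono ?_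
    rintro _ ⟨i, rfl⟩
    exact ⟨i.castSucc, rfl⟩
  · rw [← top_le_iff, ← hd x]
    refine Submodule.topologicalClosure_mono (Submodule.span_le.2 ?_)
    rintro _ ⟨k, rfl⟩
    -- With indices from `0`, the section `s k` first lies in the subbundle of rank `k + 1`.
    exact Submodule.mem_iSup_of_mem (k + 1)
      (Submodule.subset_span ⟨⟨k, k.lt_succ_self⟩, rfl⟩)
  · exact (finrank_span_eq_card (ho' d x).linearIndependent).trans (Fintype.card_fin d)
  · refine SmoothSubbundle.isLocallyModelledOn_ofOrthonormalFrame (b d) (hs' d) (ho' d) fun p => ?_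
    -- Matching all of `s k p` with the normalized `e k` yields one isometry that straightens the
    -- subbundles of every rank at `p`.
    obtain ⟨R, hR⟩ := exists_isometry_of_orthonormal_sections (ho p) (hd p)
      he.orthonormal_normalized he.dense_span_normalized
    exact ⟨R, fun i => (hR i).trans (hb d i).symm⟩
  · exact SmoothSubbundle.contMDiff_projection_ofOrthonormalFrame (b d) (hs' d) (ho' d)
  · exact ⟨SmoothSubbundle.compressCovariantDerivative _ cov, rfl,
      SmoothSubbundle.contMDiffCovariantDerivative_compressCovariantDerivative (b d) (hs' d)
        (ho' d) hcov,
      SmoothSubbundle.isCompatible_compressCovariantDerivative _ hcomp⟩
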